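/- Let $K$ be an algebraically closed field, let $d\ge 2$, and let $R=K[X_1,\dots,X_d]$ be the polynomial ring with $\deg X_j=1$. A matrix $\sigma=(a_{ij})\in\mathrm{GL}(K^d)$ acts on $R$ as the $K$-algebra automorphism with $X_j\mapsto\sum_{i=1}^d a_{ij}X_i$. Let $\sigma_1,\dots,\sigma_\ell\in \mathrm{GL}(K^d)$ be diagonal matrices, $$\sigma_i=\operatorname{diag}(\xi_i^{t_{i1}},\dots,\xi_i^{t_{id}}),$$ where $n_i\ge 1$, $\xi_i\in K$ is a primitive $n_i$-th root of unity, and the $t_{ij}$ are non-negative integers with $\gcd(t_{i1},\dots,t_{id},n_i)=1$ for every $i$. Let $G=\langle\sigma_1,\dots,\sigma_\ell\rangle$ (a finite abelian group whose order is not divisible by $\operatorname{char}K$), and put $n=\prod_{i=1}^\ell n_i$. Let $R^G=\{a\in R\mid \sigma(a)=a\text{ for all }\sigma\in G\}$ be the ring of invariants, with the grading inherited from $R$, and let $\mathfrak m_G$ be its graded maximal ideal, spanned by the homogeneous invariants of positive degree. Let ${}^*\operatorname{Spec}R^G$ be the set of graded prime ideals of $R^G$. For a character $\mathcal X$, i.e.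 a group homomorphism $\mathcal X:G\to K^\times$, let $$R^{\mathcal X}=\{a\in R\mid\sigma(a)=\mathcal X(\sigma)a\text{ for all }\sigma\in G\},$$ regarded as an $R^G$-module, and let $\operatorname{tr}_{R^G}(R^{\mathcal X})=\sum_{f\in\operatorname{Hom}_{R^G}(R^{\mathcal X},R^G)}f(R^{\mathcal X})$ be its trace ideal. An element of $G$ is a pseudo-reflection if it has finite order and its eigenspace in $K^d$ for the eigenvalue $1$ has dimension $d-1$. Fix a character $\mathcal X$ of $G$ and consider the following conditions. 1. $R^{\mathcal X}$ is locally free on ${}^*\operatorname{Spec}R^G\setminus\{\mathfrak m_G\}$, i.e. $(R^{\mathcal X})_{\mathfrak p}$ is a free $(R^G)_{\mathfrak p}$-module for every graded prime ideal $\mathfrak p\ne\mathfrak m_G$ of $R^G$. 2. The elements $X_1^n,\dots,X_d^n$ of $R^G$ satisfy $(X_1^n,\dots,X_d^n)\subseteq\operatorname{tr}_{R^G}(R^{\mathcal X})$ as ideals of $R^G$. 3. For every $1\le j\le d$ there is an integer $u_j$ with $0<u_j\le n$ and $X_j^{u_j}\in R^{\mathcal X}$. Then (3) $\Rightarrow$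 (2) $\Rightarrow$ (1). If moreover $n_1,\dots,n_\ell$ are pairwise coprime and $G$ contains no pseudo-reflection, then (1) $\Rightarrow$ (3) also holds. -/

import Mathlib

open MvPolynomial

namespace SemiInv

variable {K : Type*} [Field K] {d : ℕ}

/-- The action of `g = (a i j) ∈ GL_d(K)` on `R = K[X_1, …, X_d]`: the `K`-algebra endomorphism
with `X_j ↦ ∑ i, a i j * X_i`. -/
noncomputable def act (g : GL (Fin d) K) : MvPolynomial (Fin d) K →ₐ[K] MvPolynomial (Fin d) K :=
  aeval fun j => ∑ i, C ((g : Matrix (Fin d) (Fin d) K) i j) * X i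

/-- The ring of invariants `R^G`. -/
def invariants (G : Subgroup (GL (Fin d) K)) : Subalgebra K (MvPolynomial (Fin d) K) where
  carrier := {a | ∀ g ∈ G, act g a = a}
  mul_mem' := fun ha hb g hg => by rw [map_mul, ha g hg, hb g hg]
  add_mem' := fun ha hb g hg => by rw [map_add, ha g hg, hb g hg]
  algebraMap_mem' := fun r g _ => (act g).commutes r

/-- The module `R^χ = {a ∈ R | g(a) = χ(g) a for all g ∈ G}` of semi-invariants of weight `χ`,
an `R^G`-submodule of `R`. -/
def semiInvariants (G : Subgroup (GL (Fin d) K)) (χ : G →* Kˣ) :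
    Submodule (invariants G) (MvPolynomial (Fin d) K) where
  carrier := {a | ∀ g : G, act (g : GL (Fin d) K) a = (χ g : K) • a}
  add_mem' := fun ha hb g => by rw [map_add, ha g, hb g, smul_add]
  zero_mem' := fun g => by rw [map_zero, smul_zero]
  smul_mem' := fun c a ha g => by
    rw [Algebra.smul_def, map_mul, ha g]
    have : act (g : GL (Fin d) K) (algebraMap (invariants G) _ c) =
        algebraMap (invariants G) (MvPolynomial (Fin d) K) c := c.2 g g.2
    rw [this, mul_smul_comm]

noncomputable instance semiInvariants_module (G : Subgroup (GL (Fin d) K)) (χ : G →* Kˣ) :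
    Module (invariants G) (semiInvariants G χ) :=
  Submodule.module _

/-- The grading of `R^G` inherited from the standard grading of `R` (`deg X_j = 1`). -/
noncomputable def grading (G : Subgroup (GL (Fin d) K)) (k : ℕ) : Submodule K (invariants G) :=
  (homogeneousSubmodule (Fin d) K k).comap (invariants G).val.toLinearMap

theorem act_isHomogeneous (g : GL (Fin d) K) {k : ℕ} {f : MvPolynomial (Fin d) K}
    (hf : f.IsHomogeneous k) : (act g f).IsHomogeneous k := by
  have := hf.aeval (fun j => ∑ i, C ((g : Matrix (Fin d) (Fin d) K) i j) * X i)
    (n := 1) (fun j => IsHomogeneous.sum _ _ _ fun i _ => isHomogeneous_C_mul_X _ _)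
  simpa [act] using this

theorem homogeneousComponent_act (g : GL (Fin d) K) (k : ℕ) (f : MvPolynomial (Fin d) K) :
    homogeneousComponent k (act g f) = act g (homogeneousComponent k f) := by
  conv_lhs => rw [← sum_homogeneousComponent f, map_sum, map_sum]
  have h : ∀ i, homogeneousComponent k (act g (homogeneousComponent i f)) =
      if k = i then act g (homogeneousComponent i f) else 0 := fun i =>
    homogeneousComponent_of_mem (act_isHomogeneous g (homogeneousComponent_isHomogeneous i f))
  simp only [h, Finset.sum_ite_eq]
  split_ifs with hk
  · rfl
  · rw [homogeneousComponent_eq_zero, map_zero]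
    simpa using hk

theorem homogeneousComponent_mem_invariants (G : Subgroup (GL (Fin d) K)) (k : ℕ)
    (f : invariants G) : homogeneousComponent k (f : MvPolynomial (Fin d) K) ∈ invariants G :=
  fun g hg => by rw [← homogeneousComponent_act, f.2 g hg]

instance grading_gradedMonoid (G : Subgroup (GL (Fin d) K)) :
    SetLike.GradedMonoid (grading G) where
  one_mem := isHomogeneous_one _ _
  mul_mem := fun _ _ _ _ ha hb => IsHomogeneous.mul ha hb

theorem homogeneousComponent_coe (G : Subgroup (GL (Fin d) K))
    (x : DirectSum ℕ fun k => grading G k) (k : ℕ) :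
    homogeneousComponent k
      ((DirectSum.coeAddMonoidHom (grading G) x : invariants G) : MvPolynomial (Fin d) K) =
      ((x k : invariants G) : MvPolynomial (Fin d) K) := by
  induction x using DirectSum.induction_on with
  | zero => simp
  | of i y =>
    have hy : ((y : invariants G) : MvPolynomial (Fin d) K) ∈ homogeneousSubmodule (Fin d) K i :=
      y.2
    rw [DirectSum.coeAddMonoidHom_of, homogeneousComponent_of_mem hy]
    split_ifs with h
    · subst h
      rw [DirectSum.of_eq_same]
    · rw [DirectSum.of_eq_of_ne _ _ _ h]
      rfl
  | add x y hx hy => simp [hx, hy]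

theorem grading_isInternal (G : Subgroup (GL (Fin d) K)) :
    DirectSum.IsInternal (grading G) := by
  constructor
  · intro x y h
    refine DFinsupp.ext fun k => ?_
    apply Subtype.ext
    apply Subtype.ext
    rw [← homogeneousComponent_coe, ← homogeneousComponent_coe, h]
  · intro f
    refine ⟨∑ k ∈ Finset.range ((f : MvPolynomial (Fin d) K).totalDegree + 1),
      DirectSum.of (fun k => grading G k) k
        ⟨⟨_, homogeneousComponent_mem_invariants G k f⟩,
          homogeneousComponent_isHomogeneous k _⟩, ?_⟩
    apply Subtype.ext
    rw [map_sum]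
    simp only [DirectSum.coeAddMonoidHom_of]
    rw [AddSubmonoidClass.coe_finsetSum]
    exact sum_homogeneousComponent _

noncomputable instance grading_gradedRing (G : Subgroup (GL (Fin d) K)) :
    GradedRing (grading G) where
  toDecomposition := (grading_isInternal G).chooseDecomposition

/-- The graded maximal ideal `𝔪_G = ⨁_{k > 0} (R^G)_k` of `R^G`. -/
noncomputable def gradedMaximalIdeal (G : Subgroup (GL (Fin d) K)) : Ideal (invariants G) :=
  (HomogeneousIdeal.irrelevant (grading G)).toIdeal

/-- The set `*Spec R^G` of graded prime ideals of `R^G`. -/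
def gradedSpec (G : Subgroup (GL (Fin d) K)) : Set (PrimeSpectrum (invariants G)) :=
  {p | p.asIdeal.IsHomogeneous (grading G)}

/-- The graded punctured spectrum `*Spec R^G ∖ {𝔪_G}`. -/
def gradedPuncturedSpec (G : Subgroup (GL (Fin d) K)) : Set (PrimeSpectrum (invariants G)) :=
  gradedSpec G \ {p | p.asIdeal = gradedMaximalIdeal G}

/-- `M` is locally free on `V ⊆ Spec A`: `M_p` is a free `A_p`-module for all `p ∈ V`. -/
def LocallyFreeOn (A : Type*) [CommRing A] (M : Type*) [AddCommGroup M] [Module A M]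
    (V : Set (PrimeSpectrum A)) : Prop :=
  ∀ p ∈ V, Module.Free (Localization.AtPrime p.asIdeal)
    (LocalizedModule p.asIdeal.primeCompl M)

/-- The trace `tr_A(M) = ∑_{f ∈ Hom_A(M, A)} f(M)` of an `A`-module `M`. -/
def traceIdeal (A : Type*) [CommRing A] (M : Type*) [AddCommGroup M] [Module A M] : Ideal A :=
  ⨆ f : M →ₗ[A] A, LinearMap.range f

/-- `g ∈ GL_d(K)` is a pseudo-reflection: it has finite order, and its eigenspace for the
eigenvalue `1` has dimension `d - 1`. -/
def IsPseudoReflection (g : GL (Fin d) K) : Prop :=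
  IsOfFinOrder g ∧
    Module.finrank K (Module.End.eigenspace
      (Matrix.toLin' (g : Matrix (Fin d) (Fin d) K)) 1) + 1 = d

theorem act_one (f : MvPolynomial (Fin d) K) : act (1 : GL (Fin d) K) f = f := by
  have : act (1 : GL (Fin d) K) = AlgHom.id K _ := by
    ext j : 1
    simp [act, Matrix.one_apply]
  rw [this, AlgHom.id_apply]

theorem act_mul (g h : GL (Fin d) K) (f : MvPolynomial (Fin d) K) :
    act (g * h) f = act g (act h f) := by
  have : act (g * h) = (act g).comp (act h) := by
    ext j : 1
    simp only [act, aeval_X, AlgHom.comp_apply, map_sum, map_mul, algHom_C, algebraMap_eq,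
      Units.val_mul, Matrix.mul_apply, Finset.sum_mul, Finset.mul_sum]
    rw [Finset.sum_comm]
    exact Finset.sum_congr rfl fun i _ => Finset.sum_congr rfl fun k _ => by ring
  rw [this, AlgHom.comp_apply]

/-- If `G` is generated by the diagonal matrices `diag(ξ_i^{t_{i1}}, …, ξ_i^{t_{id}})`, where
`ξ_i` is an `N_i`-th root of unity, then `X_j ^ (∏ i, N_i)` lies in `R^G`. -/
theorem X_pow_mem_invariants {l : ℕ} {N : Fin l → ℕ} {ξ : Fin l → K} {t : Fin l → Fin d → ℕ}
    {σ : Fin l → GL (Fin d) K} {G : Subgroup (GL (Fin d) K)}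
    (hξ : ∀ i, IsPrimitiveRoot (ξ i) (N i))
    (hσ : ∀ i, (σ i : Matrix (Fin d) (Fin d) K) = Matrix.diagonal fun j => ξ i ^ t i j)
    (hG : G = Subgroup.closure (Set.range σ)) (j : Fin d) :
    (X j ^ (∏ i, N i) : MvPolynomial (Fin d) K) ∈ invariants G := by
  subst hG
  intro g hg
  induction hg using Subgroup.closure_induction with
  | mem g hg =>
    obtain ⟨i, rfl⟩ := hg
    have h1 : act (σ i) (X j) = C (ξ i ^ t i j) * X j := by
      rw [act, aeval_X, Finset.sum_eq_single j]
      · rw [hσ, Matrix.diagonal_apply_eq]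
      · intro b _ hb
        rw [hσ, Matrix.diagonal_apply_ne _ hb, C_0, zero_mul]
      · simp
    obtain ⟨c, hc⟩ := Finset.dvd_prod_of_mem N (Finset.mem_univ i)
    rw [map_pow, h1, mul_pow, ← C_pow, ← pow_mul, hc, mul_left_comm, pow_mul, (hξ i).pow_eq_one,
      one_pow, C_1, one_mul]
  | one => exact act_one _
  | mul g h _ _ ihg ihh => rw [act_mul, ihh, ihg]
  | inv g _ ih =>
    conv_lhs => rw [← ih]
    rw [← act_mul, inv_mul_cancel, act_one]

end SemiInv

open SemiInv

/-! `G` consists of diagonal matrices, so each monomial spans a stable line on which `G` acts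
through a character, its weight; `R^χ` is spanned by the monomials of weight `χ`, and all entries of
elements of `G` are `n`-th roots of unity.

(3) ⇒ (2): multiplication by `X_j^(n-u)` is a map `R^χ → R^G` sending `X_j^u` to `X_j^n`.

(2) ⇒ (1): a graded prime containing every `X_j^n` is `𝔪_G` (`eq_gradedMaximalIdeal`). At any other
graded prime `p` some `f : R^χ → R^G` takes a value `f m ∉ p`; since `R^χ` is torsion-free of rank
at most one, `f a • b = f b • a`, and `m` becomes a free generator at `p`.

(1) ⇒ (3): localize at the prime of the `j`-th coordinate axis. Freeness gives `m ∈ R^χ` such that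
each `b ∈ R^χ` satisfies `s b = c m` with `s` not vanishing on the axis. If `m` vanished there, so
would a prime factor `q` of `m`; then `q ∤ s`, so `q` divides every monomial of weight `χ` and is
some `X_k` up to a unit. Without pseudo-reflections this fails: the diagonal characters other than
the `k`-th already separate `G`, hence generate all characters (`Submonoid.eq_top_of_separates`), so
some monomial of weight `χ` avoids `X_k`. Thus `m` contains a term in `X_j^u`, whose weight is `χ`.
-/

namespace SemiInv

variable {K : Type*} [Field K] {d : ℕ}

/-! ### Diagonal groups and weights of monomials. -/

/-- The characters `ψ j` of `G` are the diagonal entries of the elements of `G`. -/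
def IsDiagonalBy (G : Subgroup (GL (Fin d) K)) (ψ : Fin d → G →* Kˣ) : Prop :=
  ∀ g : G, ((g : GL (Fin d) K) : Matrix (Fin d) (Fin d) K) =
    Matrix.diagonal fun j => (ψ j g : K)

theorem exists_diagonal_of_mem_closure {l : ℕ} {N : Fin l → ℕ} {ξ : Fin l → K}
    {t : Fin l → Fin d → ℕ} {σ : Fin l → GL (Fin d) K} {G : Subgroup (GL (Fin d) K)}
    (hN : ∀ i, 0 < N i) (hξ : ∀ i, IsPrimitiveRoot (ξ i) (N i))
    (hσ : ∀ i, (σ i : Matrix (Fin d) (Fin d) K) = Matrix.diagonal fun j => ξ i ^ t i j)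
    (hG : G = Subgroup.closure (Set.range σ)) (g : GL (Fin d) K) (hg : g ∈ G) :
    ∃ v : Fin d → Kˣ, (g : Matrix (Fin d) (Fin d) K) = Matrix.diagonal (fun j => (v j : K)) ∧
      v ^ (∏ i, N i) = 1 := by
  subst hG
  induction hg using Subgroup.closure_induction with
  | mem g hg =>
    obtain ⟨i, rfl⟩ := hg
    have h0 : ξ i ≠ 0 := (hξ i).ne_zero (hN i).ne'
    refine ⟨fun j => (Units.mk0 (ξ i) h0) ^ t i j, by simp [hσ], ?_⟩
    obtain ⟨c, hc⟩ := Finset.dvd_prod_of_mem N (Finset.mem_univ i)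
    ext j
    simp only [Pi.pow_apply, Units.val_pow_eq_pow_val, Units.val_mk0, Pi.one_apply, Units.val_one]
    rw [← pow_mul, hc, mul_left_comm, pow_mul, (hξ i).pow_eq_one, one_pow]
  | one => exact ⟨1, by simp, by simp⟩
  | mul g h _ _ ihg ihh =>
    obtain ⟨v, hv, hv'⟩ := ihg
    obtain ⟨w, hw, hw'⟩ := ihh
    exact ⟨v * w, by simp [hv, hw], by rw [mul_pow, hv', hw', one_mul]⟩
  | inv g _ ih =>
    obtain ⟨v, hv, hv'⟩ := ih
    refine ⟨v⁻¹, ?_, by rw [inv_pow, hv', inv_one]⟩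
    have : (g : Matrix (Fin d) (Fin d) K) * Matrix.diagonal (fun j => ((v⁻¹) j : K)) = 1 := by
      rw [hv, Matrix.diagonal_mul_diagonal]
      simp
    calc ((g⁻¹ : GL (Fin d) K) : Matrix (Fin d) (Fin d) K)
        = (g⁻¹ : GL (Fin d) K).val * (g.val * Matrix.diagonal (fun j => ((v⁻¹) j : K))) := by
          rw [this, mul_one]
      _ = _ := by rw [← mul_assoc, Units.inv_mul, one_mul]

theorem exists_isDiagonalBy {G : Subgroup (GL (Fin d) K)} {n : ℕ}
    (h : ∀ g ∈ G, ∃ v : Fin d → Kˣ,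
      (g : Matrix (Fin d) (Fin d) K) = Matrix.diagonal (fun j => (v j : K)) ∧ v ^ n = 1) :
    ∃ ψ : Fin d → G →* Kˣ, IsDiagonalBy G ψ ∧ ∀ j g, ψ j g ^ n = 1 := by
  choose v hv hv' using fun g : G => h g g.2
  refine ⟨fun j => ⟨⟨fun g => v g j, ?_⟩, ?_⟩, fun g => hv g, fun j g => ?_⟩
  · ext
    have := hv 1
    simpa using (congrFun (congrFun this j) j).symm
  · intro g g'
    ext
    have := hv (g * g')
    simp only [Subgroup.coe_mul, Units.val_mul, hv, Matrix.diagonal_mul_diagonal] at this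
    simpa using (congrFun (congrFun this j) j).symm
  · simpa using congrFun (hv' g) j

/-- The weight of the monomial with exponent `e`. -/
def weight {G : Type*} [Group G] (ψ : Fin d → G →* Kˣ) (e : Fin d →₀ ℕ) : G →* Kˣ where
  toFun g := ∏ i, ψ i g ^ e i
  map_one' := by simp
  map_mul' g h := by simp [mul_pow, Finset.prod_mul_distrib]

section weight

variable {G : Type*} [Group G] (ψ : Fin d → G →* Kˣ)

theorem weight_apply (e : Fin d →₀ ℕ) (g : G) : weight ψ e g = ∏ i, ψ i g ^ e i := rfl

theorem weight_zero : weight ψ 0 = 1 := by ext; simp [weight_apply]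

theorem weight_add (e f : Fin d →₀ ℕ) (g : G) :
    weight ψ (e + f) g = weight ψ e g * weight ψ f g := by
  simp [weight_apply, pow_add, Finset.prod_mul_distrib]

theorem weight_nsmul (n : ℕ) (e : Fin d →₀ ℕ) (g : G) :
    weight ψ (n • e) g = weight ψ e g ^ n := by
  simp [weight_apply, pow_mul', Finset.prod_pow]

theorem weight_single (j : Fin d) (u : ℕ) (g : G) :
    weight ψ (Finsupp.single j u) g = ψ j g ^ u := by
  rw [weight_apply, Finset.prod_eq_single j] <;>
    simp +contextual [eq_comm]

theorem weight_nsmul_eq_one {n : ℕ} (hn : ∀ j g, ψ j g ^ n = 1) (e : Fin d →₀ ℕ) :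
    weight ψ (n • e) = 1 := by
  ext g
  rw [weight_nsmul, weight_apply, ← Finset.prod_pow, Finset.prod_eq_one, MonoidHom.one_apply]
  intro i _
  rw [← pow_mul, mul_comm, pow_mul, hn, one_pow]

end weight

/-! ### Semi-invariants, the trace, and rank one. -/

variable {G : Subgroup (GL (Fin d) K)} {ψ : Fin d → G →* Kˣ} {χ : G →* Kˣ}

theorem act_X (hψ : IsDiagonalBy G ψ) (g : G) (j : Fin d) :
    act (g : GL (Fin d) K) (X j) = C (ψ j g : K) * X j := by
  rw [act, aeval_X, Finset.sum_eq_single j]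
  · rw [hψ, Matrix.diagonal_apply_eq]
  · intro b _ hb
    rw [hψ, Matrix.diagonal_apply_ne _ hb, C_0, zero_mul]
  · simp

theorem act_monomial (hψ : IsDiagonalBy G ψ) (g : G) (e : Fin d →₀ ℕ) (c : K) :
    act (g : GL (Fin d) K) (monomial e c) = monomial e ((weight ψ e g : K) * c) := by
  have h : ∏ i, (C (ψ i g : K) * X i : MvPolynomial (Fin d) K) ^ e i =
      C (weight ψ e g : K) * ∏ i, X i ^ e i := by
    simp [weight_apply, mul_pow, Finset.prod_mul_distrib]
  rw [monomial_eq, monomial_eq, Finsupp.prod_fintype _ _ (by simp), map_mul, map_prod]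
  simp only [map_pow, act_X hψ]
  rw [h, C_mul, algHom_C, algebraMap_eq]
  ring

theorem coeff_act (hψ : IsDiagonalBy G ψ) (g : G) (e : Fin d →₀ ℕ)
    (f : MvPolynomial (Fin d) K) :
    coeff e (act (g : GL (Fin d) K) f) = (weight ψ e g : K) * coeff e f := by
  induction f using MvPolynomial.induction_on' with
  | monomial e' c =>
    rw [act_monomial hψ, coeff_monomial, coeff_monomial]
    split_ifs with h
    · rw [h]
    · rw [mul_zero]
  | add p q hp hq => rw [map_add, coeff_add, coeff_add, hp, hq, mul_add]

theorem mem_semiInvariants_iff (hψ : IsDiagonalBy G ψ) {f : MvPolynomial (Fin d) K} :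
    f ∈ semiInvariants G χ ↔ ∀ e, coeff e f ≠ 0 → weight ψ e = χ := by
  constructor
  · intro hf e he
    ext g
    have := congrArg (coeff e) (hf g)
    rw [coeff_act hψ, coeff_smul, smul_eq_mul] at this
    exact mul_right_cancel₀ he this
  · intro hf g
    ext e
    rw [coeff_act hψ, coeff_smul, smul_eq_mul]
    by_cases he : coeff e f = 0
    · rw [he, mul_zero, mul_zero]
    · rw [hf e he]

theorem mem_invariants_iff_mem_semiInvariants_one {f : MvPolynomial (Fin d) K} :
    f ∈ invariants G ↔ f ∈ semiInvariants G 1 :=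
  ⟨fun hf g => by simpa using hf g g.2, fun hf g hg => by simpa using hf ⟨g, hg⟩⟩

theorem mem_invariants_iff (hψ : IsDiagonalBy G ψ) {f : MvPolynomial (Fin d) K} :
    f ∈ invariants G ↔ ∀ e, coeff e f ≠ 0 → weight ψ e = 1 := by
  rw [mem_invariants_iff_mem_semiInvariants_one, mem_semiInvariants_iff hψ]

theorem monomial_mem_semiInvariants (hψ : IsDiagonalBy G ψ) {e : Fin d →₀ ℕ}
    (he : weight ψ e = χ) (c : K) : monomial e c ∈ semiInvariants G χ := by
  rw [mem_semiInvariants_iff hψ]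
  intro e' h
  rw [coeff_monomial] at h
  split_ifs at h with h'
  · rw [← h', he]
  · exact absurd rfl h

theorem X_pow_mem_semiInvariants_iff (hψ : IsDiagonalBy G ψ) {j : Fin d} {u : ℕ} :
    (X j ^ u : MvPolynomial (Fin d) K) ∈ semiInvariants G χ ↔ ∀ g, ψ j g ^ u = χ g := by
  have h : weight ψ (Finsupp.single j u) = χ ↔ ∀ g, ψ j g ^ u = χ g := by
    simp only [DFunLike.ext_iff, weight_single]
  rw [X_pow_eq_monomial, ← h]
  exact ⟨fun h => (mem_semiInvariants_iff hψ).1 h _ (by simp),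
    fun h => monomial_mem_semiInvariants hψ h 1⟩

theorem mul_mem_semiInvariants {χ' : G →* Kˣ} {a b : MvPolynomial (Fin d) K}
    (ha : a ∈ semiInvariants G χ) (hb : b ∈ semiInvariants G χ') :
    a * b ∈ semiInvariants G (χ * χ') := fun g => by
  rw [map_mul, ha g, hb g, smul_mul_smul_comm]
  simp

theorem mul_mem_invariants {a b : MvPolynomial (Fin d) K}
    (ha : a ∈ semiInvariants G χ⁻¹) (hb : b ∈ semiInvariants G χ) : a * b ∈ invariants G := by
  rw [mem_invariants_iff_mem_semiInvariants_one, ← inv_mul_cancel χ]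
  exact mul_mem_semiInvariants ha hb

/-- Multiplication by a semi-invariant of weight `χ⁻¹`, as a map `R^χ → R^G`. -/
noncomputable def mulSemiInvariant (a : MvPolynomial (Fin d) K) (ha : a ∈ semiInvariants G χ⁻¹) :
    semiInvariants G χ →ₗ[invariants G] invariants G where
  toFun b := ⟨a * b, mul_mem_invariants ha b.2⟩
  map_add' b c := Subtype.ext (by simp [mul_add])
  map_smul' r b := Subtype.ext (by
    simp only [Submodule.coe_smul, Algebra.smul_def, RingHom.id_apply,
      MulMemClass.coe_mul]
    exact mul_left_comm _ _ _)

theorem X_pow_mem_traceIdeal (hψ : IsDiagonalBy G ψ) {j : Fin d} {u n : ℕ}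
    (hn : ∀ g, ψ j g ^ n = 1) (hu : u ≤ n)
    (h : (X j ^ u : MvPolynomial (Fin d) K) ∈ semiInvariants G χ)
    (hX : (X j ^ n : MvPolynomial (Fin d) K) ∈ invariants G) :
    (⟨X j ^ n, hX⟩ : invariants G) ∈ traceIdeal (invariants G) (semiInvariants G χ) := by
  have hc : (X j ^ (n - u) : MvPolynomial (Fin d) K) ∈ semiInvariants G χ⁻¹ := by
    rw [X_pow_mem_semiInvariants_iff hψ]
    intro g
    rw [MonoidHom.inv_apply, eq_inv_iff_mul_eq_one,
      ← (X_pow_mem_semiInvariants_iff hψ).1 h, ← pow_add, Nat.sub_add_cancel hu, hn]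
  refine Submodule.mem_iSup_of_mem (mulSemiInvariant _ hc) ⟨⟨_, h⟩, Subtype.ext ?_⟩
  change X j ^ (n - u) * X j ^ u = X j ^ n
  rw [← pow_add, Nat.sub_add_cancel hu]

/-- Since `χ^|G| = 1`, the power `χ^(|G|-1)` is `χ⁻¹`. This turns a nonzero element of `R^χ` into a
nonzero multiplier `R^χ → R^G`. -/
theorem pow_card_sub_one_mem_semiInvariants (hG : Finite G) {a : MvPolynomial (Fin d) K}
    (ha : a ∈ semiInvariants G χ) : a ^ (Nat.card G - 1) ∈ semiInvariants G χ⁻¹ := fun g => by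
  have h : χ g ^ (Nat.card G - 1) = χ⁻¹ g := by
    rw [MonoidHom.inv_apply, eq_inv_iff_mul_eq_one, ← pow_succ,
      Nat.sub_add_cancel Nat.card_pos, ← map_pow, pow_card_eq_one', map_one]
  rw [map_pow, ha g, smul_pow, ← Units.val_pow_eq_pow_val, h]

noncomputable instance : SMul (invariants G) (semiInvariants G χ) := (semiInvariants_module G χ).toSMul

theorem coe_smul_semiInvariants (r : invariants G) (b : semiInvariants G χ) :
    ((r • b : semiInvariants G χ) : MvPolynomial (Fin d) K) = r * b := rfl

/-- `R^χ` has rank one: any two elements are proportional over `R^G`. -/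
theorem exists_smul_eq_smul (hG : Finite G) {a : semiInvariants G χ} (ha : a ≠ 0)
    (b : semiInvariants G χ) :
    ∃ r s : invariants G, r ≠ 0 ∧ r • b = s • a := by
  let m := mulSemiInvariant _ (pow_card_sub_one_mem_semiInvariants hG a.2)
  have ha' : (a : MvPolynomial (Fin d) K) ≠ 0 := fun h => ha (Subtype.ext h)
  -- With `c = a^(|G|-1)` the relation is `(c a) b = (c b) a`.
  refine ⟨m a, m b, fun h => mul_ne_zero (pow_ne_zero (Nat.card G - 1) ha') ha'
    (congrArg Subtype.val h), Subtype.ext ?_⟩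
  change (_ * (a : MvPolynomial (Fin d) K)) * b = (_ * (b : MvPolynomial (Fin d) K)) * a
  ring

theorem semiInvariants_smul_eq_zero {r : invariants G} {b : semiInvariants G χ}
    (h : r • b = 0) : r = 0 ∨ b = 0 := by
  have h' : (r : MvPolynomial (Fin d) K) * b = 0 := congrArg Subtype.val h
  exact (mul_eq_zero.1 h').imp (fun h => Subtype.ext h) (fun h => Subtype.ext h)

end SemiInv

/-! ### Rank-one modules localized at a prime. -/

/-- The vector `m/1` is a basis: torsion-freeness gives independence, and `f m • b = f b • m` with
`f m` invertible gives generation. -/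
theorem localizedModule_free_of_linearMap {A M : Type*} [CommRing A] [IsDomain A]
    [AddCommGroup M] [Module A M] (p : Ideal A) [p.IsPrime]
    (hM : ∀ (a : A) (m : M), a • m = 0 → a = 0 ∨ m = 0)
    (f : M →ₗ[A] A) (m : M) (hm : f m ∉ p) (hf : ∀ a b, f a • b = f b • a) :
    Module.Free (Localization.AtPrime p) (LocalizedModule p.primeCompl M) := by
  have hm0 : m ≠ 0 := fun h => hm (by rw [h, map_zero]; exact p.zero_mem)
  let φ := LinearMap.toSpanSingleton (Localization.AtPrime p) (LocalizedModule p.primeCompl M)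
    (LocalizedModule.mk m 1)
  refine Module.Free.of_equiv (LinearEquiv.ofBijective φ ⟨?_, ?_⟩)
  · rw [← LinearMap.ker_eq_bot, LinearMap.ker_eq_bot']
    intro x hx
    induction x using Localization.induction_on with
    | H y =>
      obtain ⟨a, s⟩ := y
      rw [LinearMap.toSpanSingleton_apply, LocalizedModule.mk_smul_mk,
        ← LocalizedModule.zero_mk 1, LocalizedModule.mk_eq] at hx
      obtain ⟨⟨c, hc⟩, hx⟩ := hx
      simp only [Submonoid.smul_def, one_smul, smul_zero] at hx
      rw [smul_smul] at hx
      have hc0 : c ≠ 0 := fun h => hc (h ▸ p.zero_mem)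
      have ha : a = 0 := (mul_eq_zero.1 ((hM _ _ hx).resolve_right hm0)).resolve_left hc0
      rw [ha, Localization.mk_zero]
  · intro x
    induction x using LocalizedModule.induction_on with
    | h b s =>
      refine ⟨Localization.mk (f b) (⟨f m, hm⟩ * s), ?_⟩
      rw [LinearMap.toSpanSingleton_apply, LocalizedModule.mk_smul_mk, LocalizedModule.mk_eq]
      refine ⟨1, ?_⟩
      simp only [one_smul, mul_one, mul_smul, ← hf m b, Submonoid.smul_def]
      rw [smul_comm]

/-- Proportionality of any two elements leaves room for at most one basis vector; `m` is its
numerator. -/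
theorem exists_generator_of_localizedModule_free {A M : Type*} [CommRing A] [IsDomain A]
    [AddCommGroup M] [Module A M] (p : Ideal A) [p.IsPrime]
    (hrank : ∀ a b : M, a ≠ 0 → ∃ r s : A, r ≠ 0 ∧ r • b = s • a)
    (hfree : Module.Free (Localization.AtPrime p) (LocalizedModule p.primeCompl M)) :
    ∃ m : M, ∀ b : M, ∃ s ∉ p, ∃ c : A, s • b = c • m := by
  obtain ⟨⟨ι, B⟩⟩ := hfree.exists_basis
  -- With an empty basis the localization is zero, and `m = 0` serves.
  rcases isEmpty_or_nonempty ι with hι | ⟨⟨i⟩⟩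
  · refine ⟨0, fun b => ?_⟩
    have : Subsingleton (LocalizedModule p.primeCompl M) := B.repr.toEquiv.subsingleton
    obtain ⟨⟨c, hc⟩, h⟩ := LocalizedModule.mk_eq.1
      (Subsingleton.elim (LocalizedModule.mk b (1 : p.primeCompl)) (LocalizedModule.mk 0 1))
    simp only [Submonoid.smul_def, one_smul, smul_zero] at h
    exact ⟨c, hc, 0, by rw [h, smul_zero]⟩
  obtain ⟨m, s, hms⟩ : ∃ m s, B i = LocalizedModule.mk m s := by
    induction B i using LocalizedModule.induction_on with
    | h m s => exact ⟨m, s, rfl⟩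
  have hm0 : m ≠ 0 := by
    rintro rfl
    exact B.ne_zero i (by rw [hms, LocalizedModule.zero_mk])
  have hsub : Subsingleton ι := by
    refine ⟨fun i' j' => ?_⟩
    suffices h : ∀ j, j = i from (h i').trans (h j').symm
    intro j
    by_contra hij
    obtain ⟨m', s', hms'⟩ : ∃ m s, B j = LocalizedModule.mk m s := by
      induction B j using LocalizedModule.induction_on with
      | h m s => exact ⟨m, s, rfl⟩
    obtain ⟨r, r', hr, h⟩ := hrank m m' hm0
    -- The relation `r m' = r' m`, with denominators cleared; its `j`-th coordinate reads `s' r =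
    -- 0`, which is impossible in a domain.
    have key : Localization.mk (s' * r : A) (1 : p.primeCompl) • B j =
        Localization.mk (s * r' : A) (1 : p.primeCompl) • B i := by
      rw [hms, hms', LocalizedModule.mk_smul_mk, LocalizedModule.mk_smul_mk,
        LocalizedModule.mk_eq]
      refine ⟨1, ?_⟩
      simp only [one_smul, one_mul, mul_smul, h, Submonoid.smul_def]
      rw [smul_comm]
    have := congrArg (fun x => B.repr x j) key
    simp only [map_smul, Module.Basis.repr_self, Finsupp.smul_apply, Finsupp.single_eq_same,
      smul_eq_mul, mul_one, Finsupp.single_eq_of_ne hij, mul_zero] at this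
    rw [Localization.mk_one_eq_algebraMap, IsLocalization.to_map_eq_zero_iff _
      p.primeCompl_le_nonZeroDivisors] at this
    exact mul_ne_zero (fun h0 => s'.2 (by rw [h0]; exact p.zero_mem)) hr this
  refine ⟨m, fun b => ?_⟩
  have hb : LocalizedModule.mk b (1 : p.primeCompl) =
      B.repr (LocalizedModule.mk b (1 : p.primeCompl)) i • B i := by
    refine B.ext_elem fun j => ?_
    rw [Subsingleton.elim j i, map_smul, B.repr_self, Finsupp.smul_apply,
      Finsupp.single_eq_same, smul_eq_mul, mul_one]
  generalize B.repr (LocalizedModule.mk b (1 : p.primeCompl)) i = x at hb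
  induction x using Localization.induction_on with
  | H y =>
    obtain ⟨a, v⟩ := y
    rw [hms, LocalizedModule.mk_smul_mk, LocalizedModule.mk_eq] at hb
    obtain ⟨w, hw⟩ := hb
    refine ⟨w * (v * s), (w * (v * s)).2, w * a, ?_⟩
    simpa only [Submonoid.smul_def, Submonoid.coe_mul, mul_smul, Submonoid.coe_one, one_smul]
      using hw
-- Graded primes of the ring of invariants.
namespace SemiInv

variable {K : Type*} [Field K] {d : ℕ}
variable {G : Subgroup (GL (Fin d) K)} {ψ : Fin d → G →* Kˣ} {χ : G →* Kˣ}

theorem decompose_apply_coe (f : invariants G) (k : ℕ) :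
    ((DirectSum.decompose (grading G) f k : invariants G) : MvPolynomial (Fin d) K) =
      homogeneousComponent k (f : MvPolynomial (Fin d) K) := by
  have h : DirectSum.coeAddMonoidHom (grading G) (DirectSum.decompose (grading G) f) = f :=
    (DirectSum.decompose (grading G)).symm_apply_apply f
  rw [← homogeneousComponent_coe, h]

theorem mem_gradedMaximalIdeal_iff {f : invariants G} :
    f ∈ gradedMaximalIdeal G ↔ coeff 0 (f : MvPolynomial (Fin d) K) = 0 := by
  change f ∈ HomogeneousIdeal.irrelevant (grading G) ↔ _
  rw [HomogeneousIdeal.mem_irrelevant_iff, GradedRing.proj_apply, ← ZeroMemClass.coe_eq_zero,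
    decompose_apply_coe, homogeneousComponent_zero, C_eq_zero]

theorem X_pow_mem_invariants_of_weight (hψ : IsDiagonalBy G ψ) {n : ℕ}
    (hn : ∀ j g, ψ j g ^ n = 1) (j : Fin d) :
    (X j ^ n : MvPolynomial (Fin d) K) ∈ invariants G := by
  rw [mem_invariants_iff_mem_semiInvariants_one, X_pow_mem_semiInvariants_iff hψ]
  exact hn j

theorem eq_gradedMaximalIdeal (hψ : IsDiagonalBy G ψ) {n : ℕ} (hn : ∀ j g, ψ j g ^ n = 1)
    {p : Ideal (invariants G)} [hp : p.IsPrime]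
    (hhom : p.IsHomogeneous (grading G))
    (hX : ∀ j, (⟨X j ^ n, X_pow_mem_invariants_of_weight hψ hn j⟩ : invariants G) ∈ p) :
    p = gradedMaximalIdeal G := by
  apply le_antisymm
  · intro f hf
    rw [mem_gradedMaximalIdeal_iff]
    by_contra h0
    -- A graded prime contains the constant term of each of its elements, and a nonzero constant is
    -- a unit.
    have h1 := hhom 0 hf
    have h2 : ((DirectSum.decompose (grading G) f 0 : grading G 0) : invariants G) =
        algebraMap K (invariants G) (coeff 0 (f : MvPolynomial (Fin d) K)) := by
      apply Subtype.ext
      rw [decompose_apply_coe, homogeneousComponent_zero]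
      rfl
    rw [h2] at h1
    exact hp.ne_top (Ideal.eq_top_of_isUnit_mem _ h1 ((isUnit_iff_ne_zero.2 h0).map _))
  · intro f hf
    rw [mem_gradedMaximalIdeal_iff] at hf
    have hinv := (mem_invariants_iff hψ).1 f.2
    have hmon : ∀ e ∈ (f : MvPolynomial (Fin d) K).support,
        monomial e (coeff e (f : MvPolynomial (Fin d) K)) ∈ invariants G := fun e he =>
      mem_invariants_iff_mem_semiInvariants_one.2
        (monomial_mem_semiInvariants hψ (hinv e (mem_support_iff.1 he)) _)
    have hsum : f = ∑ e ∈ (f : MvPolynomial (Fin d) K).support.attach,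
        (⟨monomial e.1 (coeff e.1 (f : MvPolynomial (Fin d) K)), hmon e.1 e.2⟩ :
          invariants G) := by
      apply Subtype.ext
      rw [AddSubmonoidClass.coe_finsetSum]
      change _ = ∑ e ∈ (f : MvPolynomial (Fin d) K).support.attach,
        monomial e.1 (coeff e.1 (f : MvPolynomial (Fin d) K))
      rw [Finset.sum_attach _ fun e => monomial e (coeff e (f : MvPolynomial (Fin d) K))]
      exact (f : MvPolynomial (Fin d) K).as_sum
    rw [hsum]
    refine p.sum_mem fun e _ => ?_
    obtain ⟨e, he⟩ := e
    obtain ⟨j, hj⟩ : ∃ j, e j ≠ 0 := by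
      by_contra! h
      have : e = 0 := Finsupp.ext h
      exact mem_support_iff.1 he (this ▸ hf)
    -- Dividing the term itself by `X_j` may leave the invariants; in its `n`-th power the cofactor
    -- of `X_j^n` is an `n`-th power, hence invariant.
    refine hp.mem_of_pow_mem n ?_
    have hr : monomial (n • (e - Finsupp.single j 1))
        (coeff e (f : MvPolynomial (Fin d) K) ^ n) ∈ invariants G :=
      mem_invariants_iff_mem_semiInvariants_one.2
        (monomial_mem_semiInvariants hψ (weight_nsmul_eq_one ψ hn _) _)
    convert p.mul_mem_left ⟨_, hr⟩ (hX j) using 1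
    apply Subtype.ext
    change monomial e _ ^ n = monomial (n • (e - Finsupp.single j 1)) _ * X j ^ n
    rw [monomial_pow, X_pow_eq_monomial, monomial_mul, mul_one]
    congr 2
    ext i
    by_cases hi : i = j
    · subst hi
      simp only [Finsupp.smul_apply, Finsupp.add_apply, Finsupp.tsub_apply,
        Finsupp.single_eq_same, smul_eq_mul]
      rw [← Nat.mul_succ, Nat.succ_eq_add_one, Nat.sub_add_cancel (Nat.pos_of_ne_zero hj)]
    · simp [Finsupp.single_eq_of_ne hi]

/-- Applying `f` to a relation `r b = s a` gives `r f(b) = s f(a)`; then `r ≠ 0` cancels in the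
domain `R`. -/
theorem smul_eq_smul_of_linearMap (hG : Finite G)
    (f : semiInvariants G χ →ₗ[invariants G] invariants G) (a b : semiInvariants G χ) :
    f a • b = f b • a := by
  by_cases ha : a = 0
  · subst ha
    apply Subtype.ext
    rw [map_zero, coe_smul_semiInvariants, coe_smul_semiInvariants]
    exact (zero_mul _).trans (mul_zero _).symm
  obtain ⟨r, s, hr, h⟩ := exists_smul_eq_smul hG ha b
  have hf : r * f b = s * f a := by
    have := congrArg f h
    rwa [map_smul, map_smul] at this
  apply Subtype.ext
  have hr' : (r : MvPolynomial (Fin d) K) ≠ 0 := fun h0 => hr (Subtype.ext h0)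
  have h' : (r : MvPolynomial (Fin d) K) * b = s * a := congrArg Subtype.val h
  have hf' : (r : MvPolynomial (Fin d) K) * f b = s * f a := congrArg Subtype.val hf
  apply mul_left_cancel₀ hr'
  rw [coe_smul_semiInvariants, coe_smul_semiInvariants]
  linear_combination (f a : MvPolynomial (Fin d) K) * h' - (a : MvPolynomial (Fin d) K) * hf'

theorem locallyFreeOn_of_span_le_traceIdeal (hψ : IsDiagonalBy G ψ) (hG : Finite G) {n : ℕ}
    (hn : ∀ j g, ψ j g ^ n = 1)
    (h : Ideal.span (Set.range fun j : Fin d =>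
      (⟨X j ^ n, X_pow_mem_invariants_of_weight hψ hn j⟩ : invariants G)) ≤
        traceIdeal (invariants G) (semiInvariants G χ)) :
    LocallyFreeOn (invariants G) (semiInvariants G χ) (gradedPuncturedSpec G) := by
  rintro p ⟨hp, hp'⟩
  have htr : ¬ traceIdeal (invariants G) (semiInvariants G χ) ≤ p.asIdeal := fun hle =>
    hp' (eq_gradedMaximalIdeal hψ hn hp fun j =>
      hle (h (Ideal.subset_span (Set.mem_range_self j))))
  rw [traceIdeal, iSup_le_iff] at htr
  push Not at htr
  obtain ⟨f, hf⟩ := htr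
  obtain ⟨_, ⟨m, rfl⟩, hm⟩ := SetLike.not_le_iff_exists.1 hf
  exact localizedModule_free_of_linearMap p.asIdeal (fun _ _ => semiInvariants_smul_eq_zero)
    f m hm (smul_eq_smul_of_linearMap hG f)

/-! ### Localization along the coordinate axes. -/

/-- Restriction of polynomials to the `j`-th coordinate axis. -/
noncomputable def axisEval (K : Type*) [Field K] {d : ℕ} (j : Fin d) :
    MvPolynomial (Fin d) K →ₐ[K] Polynomial K :=
  aeval fun i => if i = j then Polynomial.X else 0

theorem coeff_axisEval (j : Fin d) (f : MvPolynomial (Fin d) K) (u : ℕ) :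
    (axisEval K j f).coeff u = coeff (Finsupp.single j u) f := by
  induction f using MvPolynomial.induction_on' with
  | monomial e c =>
    rw [axisEval, aeval_monomial, coeff_monomial, Finsupp.prod_fintype _ _ (by simp)]
    by_cases he : ∃ i, i ≠ j ∧ e i ≠ 0
    · obtain ⟨i, hij, hi⟩ := he
      rw [Finset.prod_eq_zero (Finset.mem_univ i) (by rw [if_neg hij, zero_pow hi]), mul_zero,
        if_neg, Polynomial.coeff_zero]
      rintro rfl
      exact hi (Finsupp.single_eq_of_ne hij)
    · push Not at he
      have he' : e = Finsupp.single j (e j) := by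
        ext i
        by_cases hij : i = j
        · rw [hij, Finsupp.single_eq_same]
        · rw [he i hij, Finsupp.single_eq_of_ne hij]
      rw [Finset.prod_eq_single j (fun i _ hij => by rw [he i hij, pow_zero]) (by simp),
        if_pos rfl, Polynomial.algebraMap_apply, Algebra.algebraMap_self_apply,
        Polynomial.coeff_C_mul_X_pow]
      have hiff : e = Finsupp.single j u ↔ u = e j := by
        rw [he', (Finsupp.single_injective j).eq_iff, Finsupp.single_eq_same, eq_comm]
      simp only [hiff]
  | add p q hp hq => rw [map_add, Polynomial.coeff_add, coeff_add, hp, hq]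

/-- The graded prime ideal of `R^G` of invariants vanishing on the `j`-th coordinate axis. -/
noncomputable def axisPrime (G : Subgroup (GL (Fin d) K)) (j : Fin d) :
    PrimeSpectrum (invariants G) :=
  ⟨RingHom.ker ((axisEval K j).comp (invariants G).val), RingHom.ker_isPrime _⟩

theorem mem_axisPrime {j : Fin d} {f : invariants G} :
    f ∈ (axisPrime G j).asIdeal ↔ axisEval K j (f : MvPolynomial (Fin d) K) = 0 :=
  Iff.rfl

/-- Restriction to the axis respects degrees, so its kernel is graded; `X_j^n` lies in `𝔪_G` but not
in that kernel. -/
theorem axisPrime_mem_gradedPuncturedSpec (hψ : IsDiagonalBy G ψ) {n : ℕ} (hn0 : 0 < n)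
    (hn : ∀ j g, ψ j g ^ n = 1) (j : Fin d) : axisPrime G j ∈ gradedPuncturedSpec G := by
  constructor
  · intro k f hf
    rw [mem_axisPrime] at hf ⊢
    ext u
    rw [coeff_axisEval, decompose_apply_coe, coeff_homogeneousComponent, ← coeff_axisEval, hf,
      Polynomial.coeff_zero, ite_self]
  · intro h
    have h1 : (⟨X j ^ n, X_pow_mem_invariants_of_weight hψ hn j⟩ : invariants G) ∈
        gradedMaximalIdeal G := by
      rw [mem_gradedMaximalIdeal_iff]
      simp [X_pow_eq_monomial, coeff_monomial, hn0.ne']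
    rw [← (h : (axisPrime G j).asIdeal = _), mem_axisPrime] at h1
    simp [axisEval] at h1

/-- A local generator at the axis prime cannot vanish on the axis, so it has a pure power of `X_j`
among its terms. The hypothesis `hmon` rules out a common factor `X_k` of all monomials of weight
`χ`. -/
theorem X_pow_mem_semiInvariants_of_locallyFreeOn (hψ : IsDiagonalBy G ψ) (hG : Finite G)
    {n : ℕ} (hn0 : 0 < n) (hn : ∀ j g, ψ j g ^ n = 1)
    (hmon : ∀ k, ∃ e : Fin d →₀ ℕ, e k = 0 ∧ weight ψ e = χ)
    (h : LocallyFreeOn (invariants G) (semiInvariants G χ) (gradedPuncturedSpec G))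
    (j : Fin d) : ∃ u : ℕ, (X j ^ u : MvPolynomial (Fin d) K) ∈ semiInvariants G χ := by
  obtain ⟨m, hm⟩ := exists_generator_of_localizedModule_free (axisPrime G j).asIdeal
    (fun a b ha => exists_smul_eq_smul hG ha b) (h _ (axisPrime_mem_gradedPuncturedSpec hψ hn0 hn j))
  have hdvd : ∀ q : MvPolynomial (Fin d) K, Prime q → q ∣ m → axisEval K j q = 0 →
      ∀ e, weight ψ e = χ → q ∣ monomial e 1 := by
    intro q hq hqm hq0 e he
    obtain ⟨s, hs, c, hsc⟩ := hm ⟨monomial e 1, monomial_mem_semiInvariants hψ he 1⟩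
    have hsc' : (s : MvPolynomial (Fin d) K) * monomial e 1 =
        (c : MvPolynomial (Fin d) K) * (m : MvPolynomial (Fin d) K) :=
      congrArg Subtype.val hsc
    -- If `q` divided `s`, then `s` would vanish on the axis with `q`.
    refine (hq.dvd_or_dvd (hsc' ▸ hqm.mul_left _)).resolve_left fun hqs => hs ?_
    obtain ⟨r, hr⟩ := hqs
    rw [mem_axisPrime, hr, map_mul, hq0, zero_mul]
  have hm0 : (m : MvPolynomial (Fin d) K) ≠ 0 := by
    intro hm0
    obtain ⟨e, -, he⟩ := hmon j
    obtain ⟨s, hs, c, hsc⟩ := hm ⟨monomial e 1, monomial_mem_semiInvariants hψ he 1⟩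
    have hsc' : (s : MvPolynomial (Fin d) K) * monomial e 1 =
        (c : MvPolynomial (Fin d) K) * (m : MvPolynomial (Fin d) K) :=
      congrArg Subtype.val hsc
    rw [hm0, mul_zero, mul_eq_zero, monomial_eq_zero] at hsc'
    exact hs (mem_axisPrime.2 (by rw [hsc'.resolve_right one_ne_zero, map_zero]))
  have hmj : axisEval K j (m : MvPolynomial (Fin d) K) ≠ 0 := by
    intro hmj
    obtain ⟨F, hF, w, hw⟩ := UniqueFactorizationMonoid.exists_prime_factors _ hm0
    have hFm : F.prod ∣ m := ⟨w, hw.symm⟩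
    have hF0 : F.prod ∈ RingHom.ker (axisEval K j) := by
      rw [← hw, map_mul] at hmj
      exact (mul_eq_zero.1 hmj).resolve_right (w.isUnit.map (axisEval K j)).ne_zero
    -- The kernel of restriction to the axis is prime in `R`, so it contains a prime factor of `m`.
    obtain ⟨q, hqF, hq0⟩ :=
      ((RingHom.ker_isPrime (axisEval K j).toRingHom).multiset_prod_mem_iff_exists_mem F).1 hF0
    have hq := hdvd q (hF q hqF) ((Multiset.dvd_prod hqF).trans hFm) hq0
    obtain ⟨e, -, he⟩ := hmon j
    obtain ⟨k, hk⟩ : ∃ k : Fin d, q ∣ X k := by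
      have := hq e he
      rw [monomial_eq, C_1, one_mul, Finsupp.prod_fintype _ _ (by simp),
        (hF q hqF).dvd_finsetProd_iff] at this
      obtain ⟨k, -, hk⟩ := this
      exact ⟨k, (hF q hqF).dvd_of_dvd_pow hk⟩
    obtain ⟨e', hek, he'⟩ := hmon k
    have hX : X k ∣ monomial e' (1 : K) :=
      ((hF q hqF).associated_of_dvd X_prime hk).symm.dvd.trans (hq e' he')
    rw [X_dvd_monomial] at hX
    exact hX.elim one_ne_zero fun h => h hek
  obtain ⟨u, hu⟩ : ∃ u, (axisEval K j (m : MvPolynomial (Fin d) K)).coeff u ≠ 0 := by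
    by_contra! h0
    exact hmj (Polynomial.ext h0)
  rw [coeff_axisEval] at hu
  refine ⟨u, ?_⟩
  rw [X_pow_eq_monomial]
  exact monomial_mem_semiInvariants hψ ((mem_semiInvariants_iff hψ).1 m.2 _ hu) 1

end SemiInv

/-! ### Counting characters. -/

/-- By Dedekind, the homomorphisms are linearly independent in the space of functions `M → K`, of
dimension `|M|`. -/
theorem card_monoidHom_le (M K : Type*) [MulOneClass M] [Finite M] [Field K] :
    Finite (M →* K) ∧ Nat.card (M →* K) ≤ Nat.card M := by
  have h := linearIndependent_monoidHom M K
  have : Finite (M →* K) := h.finite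
  have := Fintype.ofFinite M
  have := Fintype.ofFinite (M →* K)
  refine ⟨‹_›, ?_⟩
  simpa [Nat.card_eq_fintype_card] using h.fintype_card_le_finrank

theorem card_monoidHom_units_le (M K : Type*) [MulOneClass M] [Finite M] [Field K] :
    Finite (M →* Kˣ) ∧ Nat.card (M →* Kˣ) ≤ Nat.card M := by
  obtain ⟨h, h'⟩ := card_monoidHom_le M K
  have hinj : Function.Injective fun f : M →* Kˣ => (Units.coeHom K).comp f := fun f g hfg => by
    ext x
    exact DFunLike.congr_fun hfg x
  exact ⟨Finite.of_injective _ hinj, (Nat.card_le_card_of_injective _ hinj).trans h'⟩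

/-- A monoid of characters of a finite group that separates its elements contains every
character. -/
theorem Submonoid.eq_top_of_separates {G K : Type*} [Group G] [Finite G] [Field K]
    (H : Submonoid (G →* Kˣ)) (hH : ∀ g : G, (∀ φ ∈ H, φ g = 1) → g = 1) : H = ⊤ := by
  obtain ⟨hfin, hle⟩ := card_monoidHom_units_le G K
  obtain ⟨hfin', hle'⟩ := card_monoidHom_units_le H K
  let ev : G → (H →* Kˣ) := fun g =>
    { toFun := fun φ => (φ : G →* Kˣ) g
      map_one' := rfl
      map_mul' := fun _ _ => rfl }
  have hev : Function.Injective ev := fun g g' h => by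
    rw [← mul_inv_eq_one]
    refine hH _ fun φ hφ => ?_
    have : φ g = φ g' := DFunLike.congr_fun h ⟨φ, hφ⟩
    rw [map_mul, map_inv, this, mul_inv_cancel]
  -- Evaluation embeds `G` in the characters of `H`, so `|Hom(G, Kˣ)| ≤ |G| ≤ |Hom(H, Kˣ)| ≤ |H|`.
  have hcard : Nat.card (G →* Kˣ) ≤ Nat.card H :=
    hle.trans ((Nat.card_le_card_of_injective ev hev).trans hle')
  exact SetLike.coe_injective (Set.eq_of_subset_of_ncard_le (Set.subset_univ _)
    (by rwa [Submonoid.coe_top, Set.ncard_univ, ← Nat.card_coe_set_eq]) (Set.toFinite _))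

/-! ### Pseudo-reflections and monomials avoiding a variable. -/

namespace SemiInv

variable {K : Type*} [Field K] {d : ℕ}

/-- The weights of monomials free of `X_k` form a monoid of characters, and it contains each `ψ i`
with `i ≠ k`, so it separates `G`. -/
theorem exists_weight_eq {G : Type*} [Group G] [Finite G] (ψ : Fin d → G →* Kˣ) (k : Fin d)
    (hk : ∀ g, (∀ i, i ≠ k → ψ i g = 1) → g = 1) (χ : G →* Kˣ) :
    ∃ e : Fin d →₀ ℕ, e k = 0 ∧ weight ψ e = χ := by
  let H : Submonoid (G →* Kˣ) :=
    { carrier := {φ | ∃ e : Fin d →₀ ℕ, e k = 0 ∧ weight ψ e = φ}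
      one_mem' := ⟨0, rfl, weight_zero ψ⟩
      mul_mem' := by
        rintro _ _ ⟨e, he, rfl⟩ ⟨f, hf, rfl⟩
        refine ⟨e + f, by rw [Finsupp.add_apply, he, hf], MonoidHom.ext fun g => ?_⟩
        rw [weight_add, MonoidHom.mul_apply] }
  have hH : H = ⊤ := H.eq_top_of_separates fun g hg => hk g fun i hi => by
    have := hg (weight ψ (Finsupp.single i 1)) ⟨_, Finsupp.single_eq_of_ne hi.symm, rfl⟩
    rwa [weight_single, pow_one] at this
  have : χ ∈ H := hH ▸ Submonoid.mem_top χ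
  exact this

theorem isPseudoReflection_of_diagonal {g : GL (Fin d) K} {v : Fin d → K}
    (hg : (g : Matrix (Fin d) (Fin d) K) = Matrix.diagonal v) (hfin : IsOfFinOrder g)
    {k : Fin d} (hk : v k ≠ 1) (hv : ∀ i, i ≠ k → v i = 1) : IsPseudoReflection g := by
  refine ⟨hfin, ?_⟩
  -- The fixed space is the hyperplane where the `k`-th coordinate vanishes.
  have h : Module.End.eigenspace (Matrix.toLin' (g : Matrix (Fin d) (Fin d) K)) 1 =
      LinearMap.ker (LinearMap.proj k : (Fin d → K) →ₗ[K] K) := by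
    ext x
    rw [Module.End.mem_eigenspace_iff, LinearMap.mem_ker, LinearMap.proj_apply, hg,
      Matrix.toLin'_apply, one_smul]
    constructor
    · intro hx
      have := congrFun hx k
      rw [Matrix.mulVec_diagonal] at this
      by_contra h0
      exact hk (mul_right_cancel₀ h0 (this.trans (one_mul _).symm))
    · intro hx
      ext i
      rw [Matrix.mulVec_diagonal]
      by_cases hi : i = k
      · rw [hi, hx, mul_zero]
      · rw [hv i hi, one_mul]
  have hr := LinearMap.finrank_range_add_finrank_ker (LinearMap.proj k : (Fin d → K) →ₗ[K] K)
  rw [LinearMap.range_eq_top.2 (LinearMap.proj_surjective k), finrank_top, Module.finrank_self,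
    Module.finrank_fin_fun] at hr
  rw [h]
  omega

variable {G : Subgroup (GL (Fin d) K)} {ψ : Fin d → G →* Kˣ} {χ : G →* Kˣ}

theorem IsDiagonalBy.eq_one (hψ : IsDiagonalBy G ψ) {g : G} (hg : ∀ j, ψ j g = 1) : g = 1 := by
  apply Subtype.ext
  apply Units.ext
  rw [hψ g]
  simp [hg]

theorem IsDiagonalBy.finite (hψ : IsDiagonalBy G ψ) {n : ℕ} (hn0 : 0 < n)
    (hn : ∀ j g, ψ j g ^ n = 1) : Finite G := by
  have : NeZero n := ⟨hn0.ne'⟩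
  refine Finite.of_injective
    (fun (g : G) (j : Fin d) => (⟨ψ j g, (mem_rootsOfUnity n _).2 (hn j g)⟩ : rootsOfUnity n K))
    fun g g' h => ?_
  rw [← mul_inv_eq_one]
  refine hψ.eq_one fun j => ?_
  have : ψ j g = ψ j g' := congrArg Subtype.val (congrFun h j)
  rw [map_mul, map_inv, this, mul_inv_cancel]

/-- A nontrivial element killed by every `ψ i` with `i ≠ k` would be a pseudo-reflection. -/
theorem IsDiagonalBy.exists_weight_eq (hψ : IsDiagonalBy G ψ) (hG : Finite G)
    (hrefl : ∀ g ∈ G, ¬ IsPseudoReflection g) (χ : G →* Kˣ) (k : Fin d) :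
    ∃ e : Fin d →₀ ℕ, e k = 0 ∧ weight ψ e = χ := by
  refine SemiInv.exists_weight_eq ψ k (fun g hg => hψ.eq_one fun j => ?_) χ
  by_cases hj : j = k
  · subst hj
    by_contra h
    have hord : IsOfFinOrder (g : GL (Fin d) K) :=
      G.subtype.isOfFinOrder (isOfFinOrder_of_finite g)
    exact hrefl g g.2 (isPseudoReflection_of_diagonal (hψ g) hord (k := j)
      (fun h' => h (Units.ext h')) fun i hi => by rw [hg i hi, Units.val_one])
  · exact hg j hj

theorem exists_pos_le_X_pow_mem (hψ : IsDiagonalBy G ψ) {n : ℕ} (hn0 : 0 < n) {j : Fin d}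
    (hn : ∀ g, ψ j g ^ n = 1) {u : ℕ}
    (hu : (X j ^ u : MvPolynomial (Fin d) K) ∈ semiInvariants G χ) :
    ∃ u : ℕ, 0 < u ∧ u ≤ n ∧ (X j ^ u : MvPolynomial (Fin d) K) ∈ semiInvariants G χ := by
  rw [X_pow_mem_semiInvariants_iff hψ] at hu
  simp only [X_pow_mem_semiInvariants_iff hψ]
  have hmod : ∀ g, ψ j g ^ (u % n) = χ g := fun g => by
    rw [← hu g, ← pow_eq_pow_mod u (hn g)]
  -- The exponent must be positive, so residue `0` is replaced by `n`.
  rcases Nat.eq_zero_or_pos (u % n) with h0 | h0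
  · exact ⟨n, hn0, le_rfl, fun g => by rw [hn, ← hmod g, h0, pow_zero]⟩
  · exact ⟨u % n, h0, (Nat.mod_lt _ hn0).le, hmod⟩

end SemiInv

theorem theorem3p11 {K : Type*} [Field K] [IsAlgClosed K] {d : ℕ} (hd : 2 ≤ d)
    {l : ℕ} (N : Fin l → ℕ) (hN : ∀ i, 0 < N i)
    (ξ : Fin l → K) (hξ : ∀ i, IsPrimitiveRoot (ξ i) (N i))
    (t : Fin l → Fin d → ℕ) (ht : ∀ i, Nat.gcd (Finset.univ.gcd (t i)) (N i) = 1)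
    (σ : Fin l → GL (Fin d) K)
    (hσ : ∀ i, (σ i : Matrix (Fin d) (Fin d) K) = Matrix.diagonal fun j => ξ i ^ t i j)
    (G : Subgroup (GL (Fin d) K)) (hG : G = Subgroup.closure (Set.range σ))
    (χ : G →* Kˣ) :
    (((∀ j : Fin d, ∃ u : ℕ, 0 < u ∧ u ≤ ∏ i, N i ∧
        (X j ^ u : MvPolynomial (Fin d) K) ∈ semiInvariants G χ) →
      Ideal.span (Set.range fun j : Fin d =>
          (⟨X j ^ ∏ i, N i, X_pow_mem_invariants hξ hσ hG j⟩ : invariants G)) ≤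
        traceIdeal (invariants G) (semiInvariants G χ)) ∧
     (Ideal.span (Set.range fun j : Fin d =>
          (⟨X j ^ ∏ i, N i, X_pow_mem_invariants hξ hσ hG j⟩ : invariants G)) ≤
        traceIdeal (invariants G) (semiInvariants G χ) →
      LocallyFreeOn (invariants G) (semiInvariants G χ) (gradedPuncturedSpec G))) ∧
    ((∀ i j, i ≠ j → Nat.Coprime (N i) (N j)) →
      (∀ g ∈ G, ¬ IsPseudoReflection g) →
      LocallyFreeOn (invariants G) (semiInvariants G χ) (gradedPuncturedSpec G) →
      ∀ j : Fin d, ∃ u : ℕ, 0 < u ∧ u ≤ ∏ i, N i ∧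
        (X j ^ u : MvPolynomial (Fin d) K) ∈ semiInvariants G χ) := by
  have hn0 : 0 < ∏ i, N i := Finset.prod_pos fun i _ => hN i
  obtain ⟨ψ, hψ, hn⟩ := exists_isDiagonalBy (exists_diagonal_of_mem_closure hN hξ hσ hG)
  have hfin := hψ.finite hn0 hn
  refine ⟨⟨fun h => ?_, locallyFreeOn_of_span_le_traceIdeal hψ hfin hn⟩, fun _ hrefl h j => ?_⟩
  · rw [Ideal.span_le]
    rintro _ ⟨j, rfl⟩
    obtain ⟨u, -, hu, hX⟩ := h j
    exact X_pow_mem_traceIdeal hψ (hn j) hu hX _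
  · obtain ⟨u, hu⟩ := X_pow_mem_semiInvariants_of_locallyFreeOn hψ hfin hn0 hn
      (hψ.exists_weight_eq hfin hrefl χ) h j
    exact exists_pos_le_X_pow_mem hψ hn0 (hn j) hu
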